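/- There is an absolute constant $c>0$ with the following property. Let $\mu$ be a Borel probability measure on a complete separable metric space $(M,d)$, let $A\subset M$ be a closed set with $\mu(A)>0$, and let $\mu_A(B)=\mu(A\cap B)/\mu(A)$ for Borel $B\subset M$. Let $\sigma^2(\mu)\in[0,\infty]$ be the infimum of all real $\sigma^2\ge 0$ such that $$\int e^{tf}\,d\mu\le e^{\sigma^2t^2/2}\qquad\text{for all } t\in\mathbb R$$ and all $\mu$-integrable $f:M\to\mathbb R$ with $\int f\,d\mu=0$ and $|f(x)-f(y)|\le d(x,y)$ for all $x,y\in M$ ($\sigma^2(\mu)=\infty$ if there is no such $\sigma^2$). For Borel probability measures $\mu',\nu$ on $M$ let $$W_1(\mu',\nu)=\inf_\pi\iint d(x,y)\,d\pi(x,y)\in[0,\infty],$$ where the infimum is over all Borel probability measures $\pi$ on $M\times M$ with marginals $\mu'$ and $\nu$, and let $D(\nu\|\mu')=\int\log\frac{d\nu}{d\mu'}\,d\nu\in[0,\infty]$ if $\nu\ll\mu'$ and $D(\nu\|\mu')=\infty$ otherwise. Then for every Borel probability measure $\nu$ supported on $A$ (that is, $\nu(M\setminus A)=0$), $$W_1^2(\mu_A,\nu)\le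 c\,\sigma^2(\mu)\,\log\Big(\frac{e}{\mu(A)}\Big)\,D(\nu\|\mu_A).$$ Here, if $\sigma^2(\mu)=\infty$ and $D(\nu\|\mu_A)=0$, the right-hand side is read as $0$; if $\sigma^2(\mu)=0$ and $D(\nu\|\mu_A)=\infty$, it is read as $\infty$, so that nothing is claimed in this case. -/

import Mathlib

open MeasureTheory ProbabilityTheory InformationTheory
open scoped ENNReal NNReal

/-- `IsSubgaussianBound μ s` says that `s` (playing the role of `σ²`) is admissible in the definition
of the subgaussian constant: every `μ`-integrable function `f` with Lipschitz seminorm at most one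
and `μ`-mean zero satisfies `∫ exp (t f) dμ ≤ exp (s t² / 2)` for all real `t`. -/
def IsSubgaussianBound {M : Type*} [MetricSpace M] [MeasurableSpace M]
    (μ : Measure M) (s : ℝ≥0) : Prop :=
  ∀ f : M → ℝ, LipschitzWith 1 f → Integrable f μ → ∫ x, f x ∂μ = 0 →
    ∀ t : ℝ, ∫⁻ x, ENNReal.ofReal (Real.exp (t * f x)) ∂μ
      ≤ ENNReal.ofReal (Real.exp ((s : ℝ) * t ^ 2 / 2))

/-- The subgaussian constant `σ²(μ)`, with value `∞` if no finite `s` is admissible. -/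
noncomputable def subgaussianConst {M : Type*} [MetricSpace M] [MeasurableSpace M]
    (μ : Measure M) : ℝ≥0∞ :=
  ⨅ (s : ℝ≥0) (_ : IsSubgaussianBound μ s), (s : ℝ≥0∞)

/-- The Kantorovich distance `W₁(μ, ν)`: the infimum of `∫∫ d(x, y) dπ(x, y)` over all measures `π`
on `M × M` with marginals `μ` and `ν`. -/
noncomputable def kantorovichDist {M : Type*} [MetricSpace M] [MeasurableSpace M]
    (μ ν : Measure M) : ℝ≥0∞ :=
  ⨅ (π : Measure (M × M)) (_ : π.fst = μ ∧ π.snd = ν), ∫⁻ p, edist p.1 p.2 ∂π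

/-!
Write `η = μ[|A]`, `L = log (e / μ(A)) ≥ 1` and `D = D(ν‖η)`, and let `s > 0` be admissible for `μ`.
The constant `c = 32` works, because of the following three facts.

*Subgaussianity at the level of squares.* If `f` is 1-Lipschitz with `μ`-mean zero, integrating the
defining inequality against a Gaussian law of the parameter `t` gives
`∫ exp (f² / 4s) dμ ≤ √2 ≤ e` (`IsSubgaussianBound.lintegral_exp_sq_le`). Restricting to `A` costs
only the factor `1 / μ(A)`, so `∫ exp (f² / 4s) dη ≤ exp L`. By the Gibbs variational inequality
(`lintegral_ofReal_le_klDiv_add`), `∫ f² dη ≤ 4 s L` and `∫ f² dν ≤ 4 s (D + L)`. The function `f`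
is centred under `μ` and not under `η`; this is harmless, as only differences of integrals are used.

*A weighted Pinsker inequality.* With `g = dν/dη`, factor `1 - g = -(√g - 1) (√g + 1)` and apply
Cauchy–Schwarz. Since `∫ (√g - 1)² dη ≤ min D 2`, this bounds `(∫ f dη - ∫ f dν)²` by
`min D 2 * 2 (∫ f² dη + ∫ f² dν)` (`ofReal_sq_integral_sub_le`), hence by `32 s L D`: the truncation
of `D` at `2` absorbs the term `D` of the second moment under `ν`.

*Kantorovich duality.* A bound on `∫ f dη - ∫ f dν` that is uniform over 1-Lipschitz `f` bounds
`W₁(η, ν)` (`kantorovichDist_le_of_lipschitz`). Only this direction is needed, and no optimal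
coupling: it is proved for finite spaces by the Hahn–Banach theorem (`exists_coupling_of_dual_le`)
and transferred by quantizing `M` onto finitely many points with small mean displacement.

The definition of `σ²(μ)` tests integrable functions only, so the integrability of all Lipschitz
functions has to be derived: `IsSubgaussianBound.integrable_dist` does this by truncation.
-/

/-! ### Duality for finite transport problems -/

theorem sum_add_sum_eq_of_sum_eq_one {ι κ : Type*} [Fintype ι] [Fintype κ] {p : ι → ℝ} {q : κ → ℝ}
    (hp : ∑ i, p i = 1) (hq : ∑ j, q j = 1) (φ : ι → ℝ) (ψ : κ → ℝ) :
    ∑ i, p i * φ i + ∑ j, q j * ψ j = ∑ i, ∑ j, p i * q j * (φ i + ψ j) := by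
  have h1 : ∀ i, ∑ j, p i * q j * (φ i + ψ j) = p i * φ i + p i * ∑ j, q j * ψ j := by
    intro i
    calc ∑ j, p i * q j * (φ i + ψ j) = ∑ j, (q j * (p i * φ i) + p i * (q j * ψ j)) :=
          Finset.sum_congr rfl fun j _ => by ring
      _ = _ := by rw [Finset.sum_add_distrib, ← Finset.sum_mul, hq, one_mul, Finset.mul_sum]
  simp_rw [h1]
  rw [Finset.sum_add_distrib, ← Finset.sum_mul, hp, one_mul]

/-- Duality for the finite transport problem with cost `c`: an upper bound for the dual problem is
attained by a coupling. The functional `h ↦ inf {∑ p φ + ∑ q ψ + t B | h ≤ φ ⊕ ψ + t c, t ≥ 0}` on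
functions on `ι × κ` is finite by the hypothesis `hB` and sublinear. Any linear functional below it
(Hahn–Banach) is nonnegative, has marginals `p` and `q`, and takes a value at most `B` at `c`; its
matrix is the coupling. -/
theorem exists_coupling_of_dual_le {ι κ : Type*} [Fintype ι] [Fintype κ]
    {p : ι → ℝ} {q : κ → ℝ} (hp₀ : ∀ i, 0 ≤ p i) (hq₀ : ∀ j, 0 ≤ q j)
    (hp : ∑ i, p i = 1) (hq : ∑ j, q j = 1) (c : ι → κ → ℝ) (B : ℝ)
    (hB : ∀ (φ : ι → ℝ) (ψ : κ → ℝ), (∀ i j, φ i + ψ j ≤ c i j) →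
      ∑ i, p i * φ i + ∑ j, q j * ψ j ≤ B) :
    ∃ π : ι → κ → ℝ, (∀ i j, 0 ≤ π i j) ∧ (∀ i, ∑ j, π i j = p i) ∧ (∀ j, ∑ i, π i j = q j) ∧
      ∑ i, ∑ j, π i j * c i j ≤ B := by
  classical
  let S : (ι × κ → ℝ) → Set ℝ := fun h => {r | ∃ (φ : ι → ℝ) (ψ : κ → ℝ) (t : ℝ), 0 ≤ t ∧
    (∀ i j, h (i, j) ≤ φ i + ψ j + t * c i j) ∧
    r = ∑ i, p i * φ i + ∑ j, q j * ψ j + t * B}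
  have sum_const : ∀ m : ℝ, ∑ i, p i * m = m := fun m => by rw [← Finset.sum_mul, hp, one_mul]
  have habs : ∀ (h : ι × κ → ℝ) i j, |h (i, j)| ≤ ∑ x, |h x| := fun h i j =>
    Finset.single_le_sum (f := fun x => |h x|) (fun _ _ => abs_nonneg _) (Finset.mem_univ (i, j))
  have hne : ∀ h, (S h).Nonempty := fun h =>
    ⟨_, fun _ => ∑ x, |h x|, fun _ => 0, 0, le_rfl, fun i j => by
      simpa using (le_abs_self _).trans (habs h i j), rfl⟩
  have hbdd : ∀ h, BddBelow (S h) := by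
    intro h
    refine ⟨-∑ x, |h x|, ?_⟩
    rintro r ⟨φ, ψ, t, ht, hle, rfl⟩
    set m := ∑ x, |h x|
    have hm : ∀ i j, -m ≤ φ i + ψ j + t * c i j := fun i j =>
      le_trans (by have := (abs_le.1 (habs h i j)).1; linarith) (hle i j)
    -- for `t > 0` the hypothesis `hB` is applied to the potentials `(-φ - m) / t` and `-ψ / t`
    rcases ht.eq_or_lt with rfl | ht
    · -- for `t = 0` the bound is averaged against the product weights `p i * q j`
      have : -m = ∑ i, ∑ j, p i * q j * (-m) := by
        have := sum_add_sum_eq_of_sum_eq_one hp hq (fun _ => -m) (fun _ => 0)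
        rw [sum_const] at this
        simpa using this
      rw [zero_mul, add_zero, sum_add_sum_eq_of_sum_eq_one hp hq, this]
      refine Finset.sum_le_sum fun i _ => Finset.sum_le_sum fun j _ => ?_
      refine mul_le_mul_of_nonneg_left ?_ (mul_nonneg (hp₀ i) (hq₀ j))
      simpa using hm i j
    · have h1 := hB (fun i => t⁻¹ * (-φ i - m)) (fun j => t⁻¹ * (-ψ j)) (fun i j => by
        rw [← mul_add, inv_mul_le_iff₀ ht]; linarith [hm i j])
      have e1 : ∑ i, p i * (t⁻¹ * (-φ i - m)) = t⁻¹ * (-∑ i, p i * φ i - m) := by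
        rw [mul_sub, ← sum_const m, mul_neg, Finset.mul_sum, Finset.mul_sum,
          ← Finset.sum_neg_distrib, ← Finset.sum_sub_distrib]
        refine Finset.sum_congr rfl fun i _ => ?_
        rw [sum_const]; ring
      have e2 : ∑ j, q j * (t⁻¹ * (-ψ j)) = t⁻¹ * (-∑ j, q j * ψ j) := by
        rw [mul_neg, Finset.mul_sum, ← Finset.sum_neg_distrib]
        exact Finset.sum_congr rfl fun i _ => by ring
      rw [e1, e2, ← mul_add, inv_mul_le_iff₀ ht] at h1
      linarith
  have hsmul_le : ∀ a : ℝ, 0 < a → ∀ h, sInf (S (a • h)) ≤ a * sInf (S h) := by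
    intro a ha h
    rw [← inv_mul_le_iff₀ ha]
    refine le_csInf (hne h) ?_
    rintro r ⟨φ, ψ, t, ht, hle, rfl⟩
    rw [inv_mul_le_iff₀ ha]
    refine csInf_le (hbdd _) ⟨fun i => a * φ i, fun j => a * ψ j, a * t, by positivity, ?_, ?_⟩
    · intro i j
      have := mul_le_mul_of_nonneg_left (hle i j) ha.le
      simp only [Pi.smul_apply, smul_eq_mul]
      linarith
    · rw [mul_add, mul_add, Finset.mul_sum, Finset.mul_sum]
      simp only [mul_left_comm, mul_assoc]
  have hadd : ∀ h k, sInf (S (h + k)) ≤ sInf (S h) + sInf (S k) := by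
    intro h k
    rw [← csInf_add (hne h) (hbdd h) (hne k) (hbdd k)]
    refine csInf_le_csInf (hbdd _) ((hne h).add (hne k)) ?_
    rintro _ ⟨_, ⟨φ, ψ, t, ht, hle, rfl⟩, _, ⟨φ', ψ', t', ht', hle', rfl⟩, rfl⟩
    refine ⟨φ + φ', ψ + ψ', t + t', by positivity, fun i j => ?_, ?_⟩
    · have h1 := hle i j
      have h2 := hle' i j
      simp only [Pi.add_apply]
      linarith
    · simp only [Pi.add_apply, mul_add, Finset.sum_add_distrib]
      ring
  -- the functional to be extended is zero on the trivial subspace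
  obtain ⟨g, -, hg⟩ := exists_extension_of_le_sublinear (E := ι × κ → ℝ) ⟨⊥, 0⟩
    (fun h => sInf (S h))
    (fun a ha h => le_antisymm (hsmul_le a ha h) (by
      have := hsmul_le a⁻¹ (inv_pos.2 ha) (a • h)
      rw [inv_smul_smul₀ ha.ne', le_inv_mul_iff₀ ha] at this
      exact this))
    hadd (by
      rintro ⟨x, hx⟩
      obtain rfl : x = 0 := by simpa using hx
      have h0 := hadd 0 0
      rw [add_zero] at h0
      simp only [LinearMap.zero_apply, LinearPMap.mk_apply]
      linarith)
  have hgS : ∀ h, ∀ r ∈ S h, g h ≤ r := fun h r hr => (hg h).trans (csInf_le (hbdd h) hr)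
  let π : ι → κ → ℝ := fun i j => g fun x => if (i, j) = x then 1 else 0
  have hgπ : ∀ h, g h = ∑ i, ∑ j, h (i, j) * π i j := by
    intro h
    rw [LinearMap.pi_apply_eq_sum_univ g h, Fintype.sum_prod_type]
    rfl
  have hgsum : ∀ (φ : ι → ℝ) (ψ : κ → ℝ),
      g (fun x => φ x.1 + ψ x.2) = ∑ i, p i * φ i + ∑ j, q j * ψ j := by
    intro φ ψ
    refine le_antisymm (hgS _ _ ⟨φ, ψ, 0, le_rfl, by simp, by simp⟩) ?_
    have h1 := hgS (-fun x => φ x.1 + ψ x.2) _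
      ⟨fun i => -φ i, fun j => -ψ j, 0, le_rfl, by intro i j; simp, rfl⟩
    rw [map_neg] at h1
    simp only [mul_neg, Finset.sum_neg_distrib] at h1
    linarith
  refine ⟨π, fun i j => ?_, fun i => ?_, fun j => ?_, ?_⟩
  · have h1 := hgS (-fun x => if (i, j) = x then 1 else 0) 0
      ⟨0, 0, 0, le_rfl, by
        intro i' j'
        simp only [Pi.neg_apply, Pi.zero_apply]
        split_ifs <;> norm_num, by simp⟩
    rw [map_neg] at h1
    simpa [π] using h1
  · have h1 := hgsum (Pi.single i 1) 0
    rw [hgπ] at h1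
    simpa [Pi.single_apply] using h1
  · have h1 := hgsum 0 (Pi.single j 1)
    rw [hgπ] at h1
    simpa [Pi.single_apply] using h1
  · have h1 := hgS (fun x => c x.1 x.2) B ⟨0, 0, 1, zero_le_one, by simp, by simp⟩
    rw [hgπ] at h1
    simpa [mul_comm] using h1

/-! ### Kantorovich duality on separable metric spaces -/

/-- A coupling `π` of the laws of a finite-valued map `T` lifts to a coupling of `μ` and `ν`, namely
the mixture with weights `π i j` of the products of the conditional laws on the fibers of `T`. The
extra transport cost is that of moving each point `x` to the representative `e (T x)`. -/
theorem kantorovichDist_le_of_fiber_coupling {M ι : Type*} [MetricSpace M]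
    [TopologicalSpace.SeparableSpace M] [MeasurableSpace M] [BorelSpace M] [Fintype ι]
    [MeasurableSpace ι] [DiscreteMeasurableSpace ι] {μ ν : Measure M} [IsProbabilityMeasure μ]
    [IsProbabilityMeasure ν] {T : M → ι} (hT : Measurable T) (e : ι → M) {π : ι → ι → ℝ}
    (hπ : ∀ i j, 0 ≤ π i j) (hrow : ∀ i, ∑ j, π i j = μ.real (T ⁻¹' {i}))
    (hcol : ∀ j, ∑ i, π i j = ν.real (T ⁻¹' {j})) :
    kantorovichDist μ ν ≤ ∫⁻ x, edist x (e (T x)) ∂μ +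
      ENNReal.ofReal (∑ i, ∑ j, π i j * dist (e i) (e j)) + ∫⁻ x, edist (e (T x)) x ∂ν := by
  have := UniformSpace.secondCountable_of_separable M
  have hprob₁ : ∀ i j, π i j ≠ 0 → IsProbabilityMeasure μ[|T ⁻¹' {i}] := by
    intro i j h
    refine cond_isProbabilityMeasure fun h0 => h ?_
    have h1 := hrow i
    rw [measureReal_def, h0, ENNReal.toReal_zero,
      Finset.sum_eq_zero_iff_of_nonneg fun j _ => hπ i j] at h1
    exact h1 j (Finset.mem_univ j)
  have hprob₂ : ∀ i j, π i j ≠ 0 → IsProbabilityMeasure ν[|T ⁻¹' {j}] := by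
    intro i j h
    refine cond_isProbabilityMeasure fun h0 => h ?_
    have h1 := hcol j
    rw [measureReal_def, h0, ENNReal.toReal_zero,
      Finset.sum_eq_zero_iff_of_nonneg fun i _ => hπ i j] at h1
    exact h1 i (Finset.mem_univ i)
  let P : Measure (M × M) :=
    ∑ i, ∑ j, ENNReal.ofReal (π i j) • (μ[|T ⁻¹' {i}]).prod (ν[|T ⁻¹' {j}])
  have hfst : P.fst = μ := by
    conv_rhs => rw [← sum_meas_smul_cond_fiber hT μ]
    ext s hs
    rw [Measure.fst_apply hs]
    simp only [P, Measure.finsetSum_apply, Measure.smul_apply, smul_eq_mul]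
    refine Finset.sum_congr rfl fun i _ => ?_
    rw [← ofReal_measureReal (μ := μ) (s := T ⁻¹' {i}), ← hrow i,
      ENNReal.ofReal_sum_of_nonneg fun j _ => hπ i j, Finset.sum_mul]
    refine Finset.sum_congr rfl fun j _ => ?_
    by_cases h : π i j = 0
    · simp [h]
    · have := hprob₂ i j h
      rw [← Measure.fst_apply hs, Measure.fst_prod]
  have hsnd : P.snd = ν := by
    conv_rhs => rw [← sum_meas_smul_cond_fiber hT ν]
    ext s hs
    rw [Measure.snd_apply hs]
    simp only [P, Measure.finsetSum_apply, Measure.smul_apply, smul_eq_mul]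
    rw [Finset.sum_comm]
    refine Finset.sum_congr rfl fun j _ => ?_
    rw [← ofReal_measureReal (μ := ν) (s := T ⁻¹' {j}), ← hcol j,
      ENNReal.ofReal_sum_of_nonneg fun i _ => hπ i j, Finset.sum_mul]
    refine Finset.sum_congr rfl fun i _ => ?_
    by_cases h : π i j = 0
    · simp [h]
    · have := hprob₁ i j h
      rw [← Measure.snd_apply hs, Measure.snd_prod]
  have heT : Measurable fun x => e (T x) := (measurable_of_countable e).comp hT
  refine (iInf₂_le P ⟨hfst, hsnd⟩).trans ?_
  calc ∫⁻ p, edist p.1 p.2 ∂P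
      ≤ ∫⁻ p, (edist p.1 (e (T p.1)) + edist (e (T p.1)) (e (T p.2)) + edist (e (T p.2)) p.2) ∂P :=
        lintegral_mono fun p => edist_triangle4 _ _ _ _
    _ = ∫⁻ p, edist p.1 (e (T p.1)) ∂P + ∫⁻ p, edist (e (T p.1)) (e (T p.2)) ∂P +
          ∫⁻ p, edist (e (T p.2)) p.2 ∂P := by
        rw [lintegral_add_left, lintegral_add_left]
        · exact measurable_fst.edist (heT.comp measurable_fst)
        · exact (measurable_fst.edist (heT.comp measurable_fst)).add
            ((heT.comp measurable_fst).edist (heT.comp measurable_snd))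
    _ ≤ _ := by
        gcongr
        · rw [← hfst, Measure.fst, lintegral_map (measurable_id'.edist heT) measurable_fst]
        · simp only [P, lintegral_finsetSum_measure, lintegral_smul_measure, smul_eq_mul]
          rw [ENNReal.ofReal_sum_of_nonneg fun i _ =>
            Finset.sum_nonneg fun j _ => mul_nonneg (hπ i j) dist_nonneg]
          refine Finset.sum_le_sum fun i _ => ?_
          rw [ENNReal.ofReal_sum_of_nonneg fun j _ => mul_nonneg (hπ i j) dist_nonneg]
          refine Finset.sum_le_sum fun j _ => ?_
          by_cases h : π i j = 0
          · simp [h]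
          have := hprob₁ i j h
          have := hprob₂ i j h
          rw [ENNReal.ofReal_mul (hπ i j), ← edist_dist]
          refine mul_le_mul_right ?_ _
          have h1 : ∀ᵐ p ∂(μ[|T ⁻¹' {i}]).prod (ν[|T ⁻¹' {j}]), T p.1 = i :=
            Measure.quasiMeasurePreserving_fst.ae (ae_cond_mem (hT (measurableSet_singleton i)))
          have h2 : ∀ᵐ p ∂(μ[|T ⁻¹' {i}]).prod (ν[|T ⁻¹' {j}]), T p.2 = j :=
            Measure.quasiMeasurePreserving_snd.ae (ae_cond_mem (hT (measurableSet_singleton j)))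
          calc _ = ∫⁻ _, edist (e i) (e j) ∂(μ[|T ⁻¹' {i}]).prod (ν[|T ⁻¹' {j}]) :=
                lintegral_congr_ae (by filter_upwards [h1, h2] with p hp1 hp2; rw [hp1, hp2])
            _ ≤ _ := by simp
        · rw [← hsnd, Measure.snd, lintegral_map (heT.edist measurable_id') measurable_snd]

theorem integral_comp_eq_sum_fiber {M ι : Type*} [MeasurableSpace M] [Fintype ι]
    [MeasurableSpace ι] [DiscreteMeasurableSpace ι] (μ : Measure M) [IsFiniteMeasure μ]
    {T : M → ι} (hT : Measurable T) (φ : ι → ℝ) :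
    ∫ x, φ (T x) ∂μ = ∑ i, μ.real (T ⁻¹' {i}) * φ i := by
  rw [← integral_map (φ := T) (f := φ) hT.aemeasurable
    (measurable_of_countable φ).aestronglyMeasurable, integral_fintype .of_finite]
  exact Finset.sum_congr rfl fun i _ => by
    rw [map_measureReal_apply hT (measurableSet_singleton i), smul_eq_mul]

/-- Approximate duality at a fixed quantization `x ↦ e (T x)`: dual potentials of the finite problem
become, by the `c`-transform, 1-Lipschitz functions on `M`. The error is `ε` for each of `μ` and `ν`
in the dual problem, and again in lifting the coupling. -/
theorem kantorovichDist_le_of_quantization {M ι : Type*} [MetricSpace M]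
    [TopologicalSpace.SeparableSpace M] [MeasurableSpace M] [BorelSpace M] [Fintype ι]
    [MeasurableSpace ι] [DiscreteMeasurableSpace ι] {μ ν : Measure M} [IsProbabilityMeasure μ]
    [IsProbabilityMeasure ν] {T : M → ι} (hT : Measurable T) (e : ι → M) {B ε : ℝ}
    (hε : 0 ≤ ε) (hμ : ∀ f : M → ℝ, LipschitzWith 1 f → Integrable f μ)
    (hν : ∀ f : M → ℝ, LipschitzWith 1 f → Integrable f ν)
    (hB : ∀ f : M → ℝ, LipschitzWith 1 f → ∫ x, f x ∂μ - ∫ x, f x ∂ν ≤ B)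
    (hTμ : ∫⁻ x, edist (e (T x)) x ∂μ ≤ ENNReal.ofReal ε)
    (hTν : ∫⁻ x, edist (e (T x)) x ∂ν ≤ ENNReal.ofReal ε) :
    kantorovichDist μ ν ≤ ENNReal.ofReal (B + 4 * ε) := by
  have := UniformSpace.secondCountable_of_separable M
  have : Nonempty M := nonempty_of_isProbabilityMeasure μ
  have : Nonempty ι := this.map T
  have heT : Measurable fun x => e (T x) := (measurable_of_countable e).comp hT
  have hB0 : 0 ≤ B := by simpa using hB (fun _ => 0) (LipschitzWith.const' 0)
  have hmeas : Measurable fun x => edist (e (T x)) x := heT.edist measurable_id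
  have hint : ∀ η : Measure M, ∫⁻ x, edist (e (T x)) x ∂η ≤ ENNReal.ofReal ε →
      Integrable (fun x => dist (e (T x)) x) η ∧ ∫ x, dist (e (T x)) x ∂η ≤ ε := by
    intro η hη
    have hi : Integrable (fun x => dist (e (T x)) x) η := by
      refine ⟨(heT.dist measurable_id).aestronglyMeasurable, ?_⟩
      rw [hasFiniteIntegral_iff_ofReal (ae_of_all _ fun x => dist_nonneg)]
      simp_rw [← edist_dist]
      exact hη.trans_lt ENNReal.ofReal_lt_top
    refine ⟨hi, ?_⟩
    rw [integral_eq_lintegral_of_nonneg_ae (ae_of_all _ fun x => dist_nonneg) hi.1]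
    simp_rw [← edist_dist]
    exact ENNReal.toReal_le_of_le_ofReal hε hη
  obtain ⟨hμi, hμε⟩ := hint μ hTμ
  obtain ⟨hνi, hνε⟩ := hint ν hTν
  have hsum : ∀ η : Measure M, IsProbabilityMeasure η → ∑ i, η.real (T ⁻¹' {i}) = 1 := by
    intro η _
    have := integral_comp_eq_sum_fiber η hT fun _ => 1
    simpa using this.symm
  obtain ⟨π, hπ, hrow, hcol, hcost⟩ := exists_coupling_of_dual_le
    (p := fun i => μ.real (T ⁻¹' {i})) (q := fun j => ν.real (T ⁻¹' {j}))
    (fun _ => measureReal_nonneg) (fun _ => measureReal_nonneg) (hsum μ inferInstance)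
    (hsum ν inferInstance) (fun i j => dist (e i) (e j)) (B + 2 * ε) (by
      intro φ ψ hle
      -- the `c`-transform of `ψ`, a 1-Lipschitz function on the whole space
      let f : M → ℝ := fun x => Finset.univ.inf' Finset.univ_nonempty fun j => dist x (e j) - ψ j
      have hf_le : ∀ x j, f x ≤ dist x (e j) - ψ j := fun x j =>
        Finset.inf'_le (fun j => dist x (e j) - ψ j) (Finset.mem_univ j)
      have hf : LipschitzWith 1 f := by
        refine LipschitzWith.of_le_add fun x y => ?_
        rw [← sub_le_iff_le_add]
        refine Finset.le_inf' _ _ fun j _ => ?_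
        linarith [hf_le x j, dist_triangle x y (e j)]
      have hf₁ : ∀ x, φ (T x) ≤ f x + dist (e (T x)) x := fun x => by
        rw [← sub_le_iff_le_add]
        refine Finset.le_inf' _ _ fun j _ => ?_
        linarith [hle (T x) j, dist_triangle (e (T x)) x (e j)]
      have hf₂ : ∀ x, ψ (T x) ≤ dist (e (T x)) x - f x := fun x => by
        linarith [hf_le x (T x), dist_comm x (e (T x))]
      rw [← integral_comp_eq_sum_fiber μ hT, ← integral_comp_eq_sum_fiber ν hT]
      have hφi : ∀ (η : Measure M) [IsProbabilityMeasure η] (φ : ι → ℝ),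
          Integrable (fun x => φ (T x)) η := fun η _ φ =>
        Integrable.comp_measurable (f := T) (g := φ) .of_finite hT
      have h1 : ∫ x, φ (T x) ∂μ ≤ ∫ x, f x ∂μ + ∫ x, dist (e (T x)) x ∂μ := by
        rw [← integral_add (hμ f hf) hμi]
        exact integral_mono (hφi μ φ) ((hμ f hf).add hμi) hf₁
      have h2 : ∫ x, ψ (T x) ∂ν ≤ ∫ x, dist (e (T x)) x ∂ν - ∫ x, f x ∂ν := by
        rw [← integral_sub hνi (hν f hf)]
        exact integral_mono (hφi ν ψ) (hνi.sub (hν f hf)) hf₂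
      linarith [hB f hf])
  refine (kantorovichDist_le_of_fiber_coupling hT e hπ hrow hcol).trans ?_
  calc _ ≤ ENNReal.ofReal ε + ENNReal.ofReal (B + 2 * ε) + ENNReal.ofReal ε := by
        gcongr
        simpa only [edist_comm] using hTμ
    _ = ENNReal.ofReal (B + 4 * ε) := by
        rw [← ENNReal.ofReal_add hε (by positivity), ← ENNReal.ofReal_add (by positivity) hε]
        ring_nf

/-- The Kantorovich–Rubinstein bound. The quantizations are the nearest-point maps onto initial
segments of a dense sequence. -/
theorem kantorovichDist_le_of_lipschitz {M : Type*} [MetricSpace M]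
    [TopologicalSpace.SeparableSpace M] [MeasurableSpace M] [BorelSpace M] {μ ν : Measure M}
    [IsProbabilityMeasure μ] [IsProbabilityMeasure ν] {B : ℝ}
    (hμ : ∀ f : M → ℝ, LipschitzWith 1 f → Integrable f μ)
    (hν : ∀ f : M → ℝ, LipschitzWith 1 f → Integrable f ν)
    (hB : ∀ f : M → ℝ, LipschitzWith 1 f → ∫ x, f x ∂μ - ∫ x, f x ∂ν ≤ B) :
    kantorovichDist μ ν ≤ ENNReal.ofReal B := by
  have := UniformSpace.secondCountable_of_separable M
  have : Nonempty M := nonempty_of_isProbabilityMeasure μ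
  let u := TopologicalSpace.denseSeq M
  have htend : ∀ η : Measure M, (∀ f : M → ℝ, LipschitzWith 1 f → Integrable f η) →
      Filter.Tendsto (fun N => ∫⁻ x, edist (SimpleFunc.nearestPt u N x) x ∂η) Filter.atTop
        (nhds 0) := by
    intro η hη
    have hint := hη (fun x => dist (u 0) x) (LipschitzWith.dist_right _)
    rw [← lintegral_zero (μ := η)]
    refine tendsto_lintegral_of_dominated_convergence (fun x => edist (u 0) x)
      (fun N => (SimpleFunc.measurable _).edist measurable_id) (fun N => ae_of_all _ fun x =>
        SimpleFunc.edist_nearestPt_le u x (Nat.zero_le N)) ?_ (ae_of_all _ fun x => ?_)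
    · have := hint.2
      rw [hasFiniteIntegral_iff_ofReal (ae_of_all _ fun x => dist_nonneg)] at this
      simp_rw [← edist_dist] at this
      exact this.ne
    · have h := (SimpleFunc.tendsto_nearestPt (e := u) (x := x)
        (TopologicalSpace.denseRange_denseSeq M x))
      exact tendsto_iff_edist_tendsto_0.1 h
  refine le_of_forall_gt_imp_ge_of_dense fun b hb => ?_
  obtain ⟨r, hr, hrb⟩ := ENNReal.lt_iff_exists_real_btwn.1 hb |>.imp fun r h => h.2
  have hBr : B < r := by
    by_contra! h
    exact absurd hr (not_lt.2 (ENNReal.ofReal_le_ofReal h))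
  have hε : 0 < (r - B) / 4 := by linarith
  have hε' : (0 : ℝ≥0∞) < ENNReal.ofReal ((r - B) / 4) := ENNReal.ofReal_pos.2 hε
  obtain ⟨N, h1, h2⟩ := (((htend μ hμ).eventually_lt_const hε').and
    ((htend ν hν).eventually_lt_const hε')).exists
  let s := SimpleFunc.nearestPt u N
  refine le_trans ?_ hrb.le
  have := kantorovichDist_le_of_quantization (ι := s.range)
    (T := fun x => ⟨s x, s.mem_range_self x⟩) (s.measurable.subtype_mk) (fun y => (y : M))
    hε.le hμ hν hB h1.le h2.le
  rwa [show B + 4 * ((r - B) / 4) = r by ring] at this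

theorem kantorovichDist_self {M : Type*} [MetricSpace M] [TopologicalSpace.SeparableSpace M]
    [MeasurableSpace M] [BorelSpace M] (μ : Measure M) : kantorovichDist μ μ = 0 := by
  have := UniformSpace.secondCountable_of_separable M
  have hd : Measurable fun x : M => (x, x) := measurable_id.prodMk measurable_id
  have hfst : (μ.map fun x => (x, x)).fst = μ := by
    rw [Measure.fst, Measure.map_map measurable_fst hd]
    exact Measure.map_id
  have hsnd : (μ.map fun x => (x, x)).snd = μ := by
    rw [Measure.snd, Measure.map_map measurable_snd hd]
    exact Measure.map_id
  refine le_antisymm ((iInf₂_le _ ⟨hfst, hsnd⟩).trans ?_) bot_le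
  rw [lintegral_map measurable_edist hd]
  simp

/-! ### Gaussian averaging of the subgaussian inequality -/

theorem lintegral_exp_mul_gaussianReal (y : ℝ) :
    ∫⁻ x, ENNReal.ofReal (Real.exp (y * x)) ∂gaussianReal 0 1 =
      ENNReal.ofReal (Real.exp (y ^ 2 / 2)) := by
  rw [← ofReal_integral_eq_lintegral_ofReal (integrable_exp_mul_gaussianReal y)
    (ae_of_all _ fun x => (Real.exp_pos _).le)]
  have := mgf_gaussianReal (p := gaussianReal 0 1) (X := id) Measure.map_id y
  simp only [mgf, id_eq] at this
  rw [this]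
  simp

theorem lintegral_exp_sq_div_four_gaussianReal :
    ∫⁻ x, ENNReal.ofReal (Real.exp (x ^ 2 / 4)) ∂gaussianReal 0 1 = ENNReal.ofReal √2 := by
  rw [gaussianReal_of_var_ne_zero 0 one_ne_zero,
    lintegral_withDensity_eq_lintegral_mul _ (measurable_gaussianPDF 0 1) (by fun_prop)]
  have h : ∀ x : ℝ, (gaussianPDF 0 1 * fun x => ENNReal.ofReal (Real.exp (x ^ 2 / 4))) x =
      ENNReal.ofReal ((√(2 * Real.pi))⁻¹ * Real.exp (-(1 / 4) * x ^ 2)) := by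
    intro x
    rw [Pi.mul_apply, gaussianPDF, ← ENNReal.ofReal_mul (gaussianPDFReal_nonneg 0 1 x),
      gaussianPDFReal, mul_assoc, ← Real.exp_add]
    congr 3
    · simp
    · simp; ring
  simp_rw [h]
  rw [← ofReal_integral_eq_lintegral_ofReal
    ((integrable_exp_neg_mul_sq (by norm_num)).const_mul _)
    (ae_of_all _ fun x => by positivity), integral_const_mul, integral_gaussian]
  congr 1
  rw [← Real.sqrt_inv, ← Real.sqrt_mul (by positivity)]
  congr 1
  field_simp
  norm_num

/-- The mixture of `exp (t f)` over `t` distributed as `N(0, 1 / (2 s))` is `exp (f² / 4s)`, and the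
subgaussian bound turns its `μ`-integral into `∫ exp (z² / 4) dN(0, 1) = √2`. -/
theorem IsSubgaussianBound.lintegral_exp_sq_le {M : Type*} [MetricSpace M] [MeasurableSpace M]
    [OpensMeasurableSpace M] {μ : Measure M} [SFinite μ] {s : ℝ≥0} (hμ : IsSubgaussianBound μ s)
    (hs : 0 < s) {f : M → ℝ} (hf : LipschitzWith 1 f) (hfi : Integrable f μ)
    (hf0 : ∫ x, f x ∂μ = 0) :
    ∫⁻ x, ENNReal.ofReal (Real.exp (f x ^ 2 / (4 * s))) ∂μ ≤ ENNReal.ofReal (Real.exp 1) := by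
  have hs' : (0 : ℝ) < s := hs
  have hfm : Measurable f := hf.continuous.measurable
  have hr : (√(2 * s)) ^ 2 = 2 * s := Real.sq_sqrt (by positivity)
  calc ∫⁻ x, ENNReal.ofReal (Real.exp (f x ^ 2 / (4 * s))) ∂μ
      = ∫⁻ x, ∫⁻ z, ENNReal.ofReal (Real.exp (f x / √(2 * s) * z)) ∂gaussianReal 0 1 ∂μ := by
        refine lintegral_congr fun x => ?_
        rw [lintegral_exp_mul_gaussianReal, div_pow, hr, div_div]
        ring_nf
    _ = ∫⁻ z, ∫⁻ x, ENNReal.ofReal (Real.exp (f x / √(2 * s) * z)) ∂μ ∂gaussianReal 0 1 :=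
        lintegral_lintegral_swap (by fun_prop)
    _ ≤ ∫⁻ z, ENNReal.ofReal (Real.exp (z ^ 2 / 4)) ∂gaussianReal 0 1 := by
        refine lintegral_mono fun z => ?_
        have h1 := hμ f hf hfi hf0 (z / √(2 * s))
        have e1 : (s : ℝ) * (z / √(2 * s)) ^ 2 / 2 = z ^ 2 / 4 := by
          rw [div_pow, hr]; field_simp; norm_num
        rw [e1] at h1
        refine le_trans (le_of_eq (lintegral_congr fun x => ?_)) h1
        congr 2
        ring
    _ = ENNReal.ofReal √2 := lintegral_exp_sq_div_four_gaussianReal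
    _ ≤ _ := by
        refine ENNReal.ofReal_le_ofReal ?_
        rw [Real.sqrt_le_left (Real.exp_pos 1).le]
        nlinarith [Real.add_one_le_exp 1]

theorem lintegral_ofReal_le_lintegral_exp {M : Type*} [MeasurableSpace M] {μ : Measure M}
    {φ : M → ℝ} :
    ∫⁻ x, ENNReal.ofReal (φ x) ∂μ ≤ ∫⁻ x, ENNReal.ofReal (Real.exp (φ x)) ∂μ :=
  lintegral_mono fun x => ENNReal.ofReal_le_ofReal (by linarith [Real.add_one_le_exp (φ x)])

/-- The truncations `min (d(x, x₀)) n` are integrable, so they concentrate around their means `m n`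
uniformly in `n`. On a ball of mass at least `1 / 2` they are bounded by its radius `r`, so `m n`
cannot exceed `r` by more than a constant, and monotone convergence applies. -/
theorem IsSubgaussianBound.integrable_dist {M : Type*} [MetricSpace M] [MeasurableSpace M]
    [OpensMeasurableSpace M] {μ : Measure M} [IsProbabilityMeasure μ] {s : ℝ≥0}
    (hμ : IsSubgaussianBound μ s) (hs : 0 < s) (x₀ : M) : Integrable (fun x => dist x x₀) μ := by
  have hs' : (0 : ℝ) < s := hs
  let g : ℕ → M → ℝ := fun n x => min (dist x x₀) n
  have hg : ∀ n, LipschitzWith 1 (g n) := fun n => (LipschitzWith.dist_left x₀).min_const n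
  have hg0 : ∀ n x, 0 ≤ g n x := fun n x => le_min dist_nonneg n.cast_nonneg
  have hgi : ∀ n, Integrable (g n) μ := fun n =>
    Integrable.of_bound (hg n).continuous.measurable.aestronglyMeasurable n
      (ae_of_all _ fun x => by rw [Real.norm_of_nonneg (hg0 n x)]; exact min_le_right _ _)
  let m : ℕ → ℝ := fun n => ∫ x, g n x ∂μ
  have hexp : ∀ n, ∫⁻ x, ENNReal.ofReal (Real.exp ((g n x - m n) ^ 2 / (4 * s))) ∂μ ≤
      ENNReal.ofReal (Real.exp 1) := fun n => by
    refine hμ.lintegral_exp_sq_le hs (f := fun x => g n x - m n) ?_ ((hgi n).sub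
      (integrable_const _)) ?_
    · simpa using (hg n).sub (LipschitzWith.const (m n))
    · rw [integral_sub (hgi n) (integrable_const _)]
      simp [m]
  -- some ball carries at least half of the mass
  obtain ⟨r, hr⟩ : ∃ r : ℕ, 1 / 2 < μ (Metric.ball x₀ r) := by
    have h := tendsto_measure_iUnion_atTop (μ := μ) (s := fun n : ℕ => Metric.ball x₀ n)
      (fun a b hab => Metric.ball_subset_ball (Nat.cast_le.2 hab))
    rw [Metric.iUnion_ball_nat, measure_univ] at h
    exact (h.eventually_const_lt (by norm_num)).exists
  have hm : ∀ n, m n ≤ r + √(8 * s * Real.exp 1) := by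
    intro n
    rcases le_total (m n) r with h | h
    · exact h.trans (by linarith [Real.sqrt_nonneg (8 * s * Real.exp 1)])
    have h1 : ENNReal.ofReal ((m n - r) ^ 2 / (4 * s)) * μ (Metric.ball x₀ r) ≤
        ENNReal.ofReal (Real.exp 1) := by
      refine le_trans ?_ (lintegral_ofReal_le_lintegral_exp.trans (hexp n))
      rw [← setLIntegral_const]
      refine le_trans ?_ (setLIntegral_le_lintegral (Metric.ball x₀ r) _)
      refine setLIntegral_mono' Metric.isOpen_ball.measurableSet fun x hx => ?_
      refine ENNReal.ofReal_le_ofReal ?_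
      gcongr 1
      have hx' : g n x ≤ r := (min_le_left _ _).trans (Metric.mem_ball.1 hx).le
      nlinarith
    have h2 : ENNReal.ofReal ((m n - r) ^ 2 / (4 * s) * (1 / 2)) ≤ ENNReal.ofReal (Real.exp 1) := by
      rw [ENNReal.ofReal_mul (by positivity)]
      refine le_trans (mul_le_mul_right (le_trans (le_of_eq ?_) hr.le) _) h1
      rw [ENNReal.ofReal_div_of_pos two_pos]
      simp
    rw [ENNReal.ofReal_le_ofReal_iff (Real.exp_pos 1).le, div_mul_div_comm,
      div_le_iff₀ (by positivity)] at h2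
    have h3 := Real.le_sqrt_of_sq_le (x := m n - r) (y := 8 * s * Real.exp 1) (by linarith)
    linarith
  refine ⟨by fun_prop, ?_⟩
  rw [hasFiniteIntegral_iff_ofReal (ae_of_all _ fun x => dist_nonneg)]
  have htend : Filter.Tendsto (fun n => ∫⁻ x, ENNReal.ofReal (g n x) ∂μ) Filter.atTop
      (nhds (∫⁻ x, ENNReal.ofReal (dist x x₀) ∂μ)) := by
    refine lintegral_tendsto_of_tendsto_of_monotone
      (fun n => (hg n).continuous.measurable.ennreal_ofReal.aemeasurable)
      (ae_of_all _ fun x a b hab => ENNReal.ofReal_le_ofReal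
        (min_le_min_left _ (Nat.cast_le.2 hab))) (ae_of_all _ fun x => ?_)
    obtain ⟨k, hk⟩ := exists_nat_ge (dist x x₀)
    refine tendsto_atTop_of_eventually_const (i₀ := k) fun n hn => ?_
    simp only [g]
    rw [min_eq_left (hk.trans (Nat.cast_le.2 hn))]
  refine (le_of_tendsto' htend fun n => ?_).trans_lt
    (ENNReal.ofReal_lt_top (r := r + √(8 * s * Real.exp 1)))
  rw [← ofReal_integral_eq_lintegral_ofReal (hgi n) (ae_of_all _ (hg0 n))]
  exact ENNReal.ofReal_le_ofReal (hm n)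

theorem LipschitzWith.integrable_of_integrable_dist {M : Type*} [MetricSpace M]
    [MeasurableSpace M] [OpensMeasurableSpace M] {μ : Measure M} [IsFiniteMeasure μ] {x₀ : M}
    (h : Integrable (fun x => dist x x₀) μ) {f : M → ℝ} (hf : LipschitzWith 1 f) :
    Integrable f μ := by
  refine (h.add (integrable_const |f x₀|)).mono'
    hf.continuous.measurable.aestronglyMeasurable (ae_of_all _ fun x => ?_)
  have h1 := hf.dist_le_mul x x₀
  rw [NNReal.coe_one, one_mul, Real.dist_eq] at h1
  have h2 := abs_add_le (f x - f x₀) (f x₀)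
  rw [sub_add_cancel] at h2
  simpa using h2.trans (add_le_add_left h1 _)

/-! ### Relative entropy: the Gibbs variational inequality and a weighted Pinsker inequality -/

/-- Young's inequality for the convex conjugate pair `klFun`, `y ↦ exp y - 1`, shifted by `L`. -/
theorem mul_add_one_le_klFun_add {g : ℝ} (hg : 0 ≤ g) (y L : ℝ) :
    g * y + 1 ≤ klFun g + Real.exp (y - L) + g * L := by
  rw [klFun_apply]
  rcases hg.eq_or_lt with rfl | hg
  · simpa using (Real.exp_pos _).le
  · have h1 := mul_le_mul_of_nonneg_left (Real.add_one_le_exp (y - L - Real.log g)) hg.le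
    rw [Real.exp_sub (y - L), Real.exp_log hg, mul_div_cancel₀ _ hg.ne'] at h1
    linarith

theorem lintegral_ofReal_toReal_rnDeriv_mul {M : Type*} [MeasurableSpace M] {η ν : Measure M}
    [SigmaFinite η] [SigmaFinite ν] (hac : ν ≪ η) {ψ : M → ℝ} (hψ : Measurable ψ) :
    ∫⁻ x, ENNReal.ofReal ((ν.rnDeriv η x).toReal * ψ x) ∂η = ∫⁻ x, ENNReal.ofReal (ψ x) ∂ν := by
  rw [← lintegral_rnDeriv_mul hac hψ.ennreal_ofReal.aemeasurable]
  refine lintegral_congr_ae ?_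
  filter_upwards [Measure.rnDeriv_ne_top ν η] with x hx
  rw [ENNReal.ofReal_mul ENNReal.toReal_nonneg, ENNReal.ofReal_toReal hx]

/-- The Gibbs (Donsker–Varadhan) variational inequality `∫ φ dν ≤ D(ν‖η) + log ∫ exp φ dη` for
`φ ≥ 0`. Infinite values are allowed on both sides. -/
theorem lintegral_ofReal_le_klDiv_add {M : Type*} [MeasurableSpace M] {η ν : Measure M}
    [IsProbabilityMeasure η] [IsProbabilityMeasure ν] {φ : M → ℝ} (hφ : Measurable φ)
    (hφ0 : ∀ x, 0 ≤ φ x) {L : ℝ} (hL : 0 ≤ L)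
    (h : ∫⁻ x, ENNReal.ofReal (Real.exp (φ x)) ∂η ≤ ENNReal.ofReal (Real.exp L)) :
    ∫⁻ x, ENNReal.ofReal (φ x) ∂ν ≤ klDiv ν η + ENNReal.ofReal L := by
  rw [klDiv_eq_lintegral_klFun]
  split_ifs with hac
  swap
  · simp
  set g : M → ℝ := fun x => (ν.rnDeriv η x).toReal
  have hgm : Measurable g := (Measure.measurable_rnDeriv ν η).ennreal_toReal
  have hg0 : ∀ x, 0 ≤ g x := fun x => ENNReal.toReal_nonneg
  have hchange : ∀ ψ : M → ℝ, Measurable ψ →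
      ∫⁻ x, ENNReal.ofReal (g x * ψ x) ∂η = ∫⁻ x, ENNReal.ofReal (ψ x) ∂ν :=
    fun ψ hψ => lintegral_ofReal_toReal_rnDeriv_mul hac hψ
  have hexp : ∫⁻ x, ENNReal.ofReal (Real.exp (φ x - L)) ∂η ≤ 1 := by
    have : ∀ x, ENNReal.ofReal (Real.exp (φ x - L)) =
        ENNReal.ofReal (Real.exp (φ x)) * ENNReal.ofReal (Real.exp (-L)) := fun x => by
      rw [← ENNReal.ofReal_mul (Real.exp_pos _).le, ← Real.exp_add, sub_eq_add_neg]
    simp_rw [this]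
    rw [lintegral_mul_const _ (by fun_prop)]
    refine (mul_le_mul_left h _).trans ?_
    rw [← ENNReal.ofReal_mul (Real.exp_pos _).le, ← Real.exp_add]
    simp
  -- the summand `1` keeps all integrands of the pointwise inequality nonnegative
  refine (ENNReal.add_le_add_iff_right (a := 1) ENNReal.one_ne_top).1 ?_
  calc ∫⁻ x, ENNReal.ofReal (φ x) ∂ν + 1
      = ∫⁻ x, ENNReal.ofReal (g x * φ x) + 1 ∂η := by
        rw [lintegral_add_right _ measurable_const, hchange φ hφ]
        simp
    _ ≤ ∫⁻ x, (ENNReal.ofReal (klFun (g x)) + ENNReal.ofReal (Real.exp (φ x - L)) +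
          ENNReal.ofReal (g x * L)) ∂η := by
        refine lintegral_mono fun x => ?_
        have hk := klFun_nonneg (hg0 x)
        rw [← ENNReal.ofReal_one, ← ENNReal.ofReal_add (mul_nonneg (hg0 x) (hφ0 x)) zero_le_one,
          ← ENNReal.ofReal_add hk (Real.exp_pos _).le,
          ← ENNReal.ofReal_add (by positivity) (mul_nonneg (hg0 x) hL)]
        exact ENNReal.ofReal_le_ofReal (mul_add_one_le_klFun_add (hg0 x) _ _)
    _ = ∫⁻ x, ENNReal.ofReal (klFun (g x)) ∂η + ∫⁻ x, ENNReal.ofReal (Real.exp (φ x - L)) ∂η +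
          ENNReal.ofReal L := by
        rw [lintegral_add_right _ (by fun_prop), lintegral_add_right _ (by fun_prop),
          hchange (fun _ => L) measurable_const]
        simp
    _ ≤ ∫⁻ x, ENNReal.ofReal (klFun (g x)) ∂η + 1 + ENNReal.ofReal L := by gcongr
    _ = _ := by ring

theorem sq_lintegral_mul_le {M : Type*} [MeasurableSpace M] (η : Measure M) {u v : M → ℝ≥0∞}
    (hu : AEMeasurable u η) (hv : AEMeasurable v η) :
    (∫⁻ x, u x * v x ∂η) ^ 2 ≤ (∫⁻ x, u x ^ 2 ∂η) * ∫⁻ x, v x ^ 2 ∂η := by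
  have h := ENNReal.lintegral_mul_le_Lp_mul_Lq η Real.HolderConjugate.two_two hu hv
  have h2 := pow_le_pow_left₀ bot_le h 2
  simp only [Pi.mul_apply, ENNReal.rpow_two] at h2
  have hroot : ∀ a : ℝ≥0∞, (a ^ (1 / 2 : ℝ)) ^ 2 = a := fun a => by
    rw [← ENNReal.rpow_two, ← ENNReal.rpow_mul, one_div, inv_mul_cancel₀ two_ne_zero,
      ENNReal.rpow_one]
  rwa [mul_pow, hroot, hroot] at h2

theorem sqrt_sub_one_sq_le_klFun {g : ℝ} (hg : 0 ≤ g) : (√g - 1) ^ 2 ≤ klFun g := by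
  rw [klFun_apply]
  obtain ⟨r, hr, rfl⟩ : ∃ r, 0 ≤ r ∧ g = r ^ 2 := ⟨√g, Real.sqrt_nonneg g, (Real.sq_sqrt hg).symm⟩
  rw [Real.sqrt_sq hr]
  rcases hr.eq_or_lt with rfl | hr
  · norm_num
  · have h1 := mul_le_mul_of_nonneg_left (Real.one_sub_inv_le_log_of_pos hr) (sq_nonneg r)
    rw [mul_sub, sq r, mul_assoc r r r⁻¹, mul_inv_cancel₀ hr.ne'] at h1
    rw [Real.log_pow]
    push_cast
    nlinarith

/-- A weighted Pinsker inequality: the squared Hellinger distance of `ν` and `η` is at most both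
`klDiv ν η` and `2`, and Cauchy–Schwarz brings in the second moments of `f`. -/
theorem ofReal_sq_integral_sub_le {M : Type*} [MeasurableSpace M] {η ν : Measure M}
    [IsProbabilityMeasure η] [IsProbabilityMeasure ν] {f : M → ℝ} (hf : Measurable f)
    (hη : Integrable f η) (hν : Integrable f ν) (hac : ν ≪ η) :
    ENNReal.ofReal ((∫ x, f x ∂η - ∫ x, f x ∂ν) ^ 2) ≤
      min (klDiv ν η) 2 *
        (2 * (∫⁻ x, ENNReal.ofReal (f x ^ 2) ∂η + ∫⁻ x, ENNReal.ofReal (f x ^ 2) ∂ν)) := by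
  set g : M → ℝ := fun x => (ν.rnDeriv η x).toReal
  have hgm : Measurable g := (Measure.measurable_rnDeriv ν η).ennreal_toReal
  have hg0 : ∀ x, 0 ≤ g x := fun x => ENNReal.toReal_nonneg
  have hchange : ∀ ψ : M → ℝ, Measurable ψ →
      ∫⁻ x, ENNReal.ofReal (g x * ψ x) ∂η = ∫⁻ x, ENNReal.ofReal (ψ x) ∂ν :=
    fun ψ hψ => lintegral_ofReal_toReal_rnDeriv_mul hac hψ
  have hfac : ∀ x, f x - g x * f x = (√(g x) - 1) * (-(f x * (√(g x) + 1))) := fun x => by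
    nth_rw 1 [← Real.sq_sqrt (hg0 x)]; ring
  have hdiff : ∫ x, f x ∂η - ∫ x, f x ∂ν = ∫ x, (√(g x) - 1) * (-(f x * (√(g x) + 1))) ∂η := by
    rw [← integral_rnDeriv_smul hac]
    rw [← integral_sub hη ((integrable_rnDeriv_smul_iff hac).2 hν)]
    exact integral_congr_ae (ae_of_all _ hfac)
  have hHell : ∫⁻ x, ENNReal.ofReal |√(g x) - 1| ^ 2 ∂η ≤ min (klDiv ν η) 2 := by
    simp_rw [← ENNReal.ofReal_pow (abs_nonneg _), sq_abs]
    refine le_min ?_ ?_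
    · rw [klDiv_eq_lintegral_klFun_of_ac hac]
      exact lintegral_mono fun x => ENNReal.ofReal_le_ofReal (sqrt_sub_one_sq_le_klFun (hg0 x))
    · calc _ ≤ ∫⁻ x, (ENNReal.ofReal (g x * 1) + 1) ∂η := by
            refine lintegral_mono fun x => ?_
            rw [← ENNReal.ofReal_one, ← ENNReal.ofReal_add (by simpa using hg0 x) zero_le_one]
            refine ENNReal.ofReal_le_ofReal ?_
            nlinarith [Real.sq_sqrt (hg0 x), Real.sqrt_nonneg (g x)]
        _ = 2 := by
            rw [lintegral_add_right _ measurable_const, hchange (fun _ => 1) measurable_const]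
            simp [one_add_one_eq_two]
  have hsecond : ∫⁻ x, ENNReal.ofReal |-(f x * (√(g x) + 1))| ^ 2 ∂η ≤
      2 * (∫⁻ x, ENNReal.ofReal (f x ^ 2) ∂η + ∫⁻ x, ENNReal.ofReal (f x ^ 2) ∂ν) := by
    rw [← hchange (fun x => f x ^ 2) (hf.pow_const 2), ← lintegral_add_right _ (by fun_prop),
      ← lintegral_const_mul _ (by fun_prop)]
    refine lintegral_mono fun x => ?_
    rw [← ENNReal.ofReal_pow (abs_nonneg _), sq_abs,
      ← ENNReal.ofReal_add (sq_nonneg _) (mul_nonneg (hg0 x) (sq_nonneg _)),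
      ← ENNReal.ofReal_ofNat 2, ← ENNReal.ofReal_mul (by norm_num)]
    refine ENNReal.ofReal_le_ofReal ?_
    have h1 : (√(g x) + 1) ^ 2 ≤ 2 * (1 + g x) := by
      nlinarith [Real.sq_sqrt (hg0 x), sq_nonneg (√(g x) - 1)]
    nlinarith [mul_le_mul_of_nonneg_left h1 (sq_nonneg (f x))]
  calc ENNReal.ofReal ((∫ x, f x ∂η - ∫ x, f x ∂ν) ^ 2)
      = ‖∫ x, (√(g x) - 1) * (-(f x * (√(g x) + 1))) ∂η‖ₑ ^ 2 := by
        rw [hdiff, Real.enorm_eq_ofReal_abs, ← ENNReal.ofReal_pow (abs_nonneg _), sq_abs]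
    _ ≤ (∫⁻ x, ENNReal.ofReal |√(g x) - 1| * ENNReal.ofReal |-(f x * (√(g x) + 1))| ∂η) ^ 2 := by
        gcongr
        refine (enorm_integral_le_lintegral_enorm _).trans_eq (lintegral_congr fun x => ?_)
        rw [Real.enorm_eq_ofReal_abs, abs_mul, ENNReal.ofReal_mul (abs_nonneg _)]
    _ ≤ _ := (sq_lintegral_mul_le η (by fun_prop) (by fun_prop)).trans
        (mul_le_mul' hHell hsecond)

/-! ### Conditioning and the transport inequality -/

theorem IsSubgaussianBound.mono {M : Type*} [MetricSpace M] [MeasurableSpace M] {μ : Measure M}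
    {s t : ℝ≥0} (h : IsSubgaussianBound μ s) (hst : s ≤ t) : IsSubgaussianBound μ t :=
  fun f hf hfi hf0 r => (h f hf hfi hf0 r).trans (ENNReal.ofReal_le_ofReal (by gcongr))

theorem integrable_of_lintegral_sq_ne_top {M : Type*} [MeasurableSpace M] {η : Measure M}
    [IsFiniteMeasure η] {f : M → ℝ} (hf : Measurable f)
    (h : ∫⁻ x, ENNReal.ofReal (f x ^ 2) ∂η ≠ ∞) : Integrable f η := by
  have h2 : Integrable (fun x => f x ^ 2) η := by
    refine ⟨by fun_prop, ?_⟩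
    rw [hasFiniteIntegral_iff_ofReal (ae_of_all _ fun x => sq_nonneg _)]
    exact h.lt_top
  refine (h2.add (integrable_const 1)).mono' (by fun_prop) (ae_of_all _ fun x => ?_)
  rw [Real.norm_eq_abs, Pi.add_apply, ← sq_abs]
  nlinarith [sq_nonneg (|f x| - 1), abs_nonneg (f x)]

theorem min_two_mul_le {D L : ℝ≥0∞} (hL : 1 ≤ L) : min D 2 * (D + 2 * L) ≤ 4 * L * D := by
  rcases le_total D 2 with h | h
  · calc min D 2 * (D + 2 * L) ≤ D * (2 * L + 2 * L) := by
          gcongr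
          · exact min_le_left _ _
          · exact h.trans (le_mul_of_one_le_right' hL)
      _ = 4 * L * D := by ring
  · calc min D 2 * (D + 2 * L) ≤ 2 * (D * L + D * L) := by
          gcongr
          · exact min_le_right _ _
          · exact le_mul_of_one_le_right' hL
      _ = 4 * L * D := by ring

theorem lintegral_cond_le {M : Type*} [MeasurableSpace M] {μ : Measure M} (A : Set M)
    (u : M → ℝ≥0∞) : ∫⁻ x, u x ∂μ[|A] ≤ (μ A)⁻¹ * ∫⁻ x, u x ∂μ := by
  rw [ProbabilityTheory.cond, lintegral_smul_measure, smul_eq_mul]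
  gcongr
  exact Measure.restrict_le_self

theorem one_le_log_exp_one_div {a : ℝ} (ha : 0 < a) (ha1 : a ≤ 1) :
    1 ≤ Real.log (Real.exp 1 / a) := by
  rw [Real.log_div (Real.exp_pos 1).ne' ha.ne', Real.log_exp]
  linarith [Real.log_nonpos ha.le ha1]

/-- The transport-entropy inequality for the conditional measure at an admissible `s > 0`. -/
theorem IsSubgaussianBound.kantorovichDist_cond_sq_le {M : Type*} [MetricSpace M]
    [TopologicalSpace.SeparableSpace M] [MeasurableSpace M] [BorelSpace M] {μ : Measure M}
    [IsProbabilityMeasure μ] {s : ℝ≥0} (hμ : IsSubgaussianBound μ s) (hs : 0 < s) {A : Set M}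
    (hA : 0 < μ A) {ν : Measure M} [IsProbabilityMeasure ν] (hD : klDiv ν μ[|A] ≠ ∞) :
    kantorovichDist μ[|A] ν ^ 2 ≤
      32 * s * ENNReal.ofReal (Real.log (Real.exp 1 / μ.real A)) * klDiv ν μ[|A] := by
  have hηp : IsProbabilityMeasure μ[|A] := cond_isProbabilityMeasure hA.ne'
  have hs' : (0 : ℝ) < s := hs
  set η := μ[|A] with hη
  set D := klDiv ν η
  have ha : 0 < μ.real A := ENNReal.toReal_pos hA.ne' (measure_ne_top _ _)
  have hL : 1 ≤ Real.log (Real.exp 1 / μ.real A) := one_le_log_exp_one_div ha measureReal_le_one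
  have hexpL : Real.exp (Real.log (Real.exp 1 / μ.real A)) = Real.exp 1 / μ.real A :=
    Real.exp_log (by positivity)
  set L := Real.log (Real.exp 1 / μ.real A)
  have hL' : 1 ≤ ENNReal.ofReal L := ENNReal.one_le_ofReal.2 hL
  obtain ⟨x₀⟩ : Nonempty M := nonempty_of_isProbabilityMeasure μ
  have hdist := hμ.integrable_dist hs x₀
  have hac : ν ≪ η := (klDiv_ne_top_iff.1 hD).1
  -- second moment bounds, and the resulting estimate, for a Lipschitz function
  have key : ∀ f : M → ℝ, LipschitzWith 1 f → Integrable f η ∧ Integrable f ν ∧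
      ENNReal.ofReal ((∫ x, f x ∂η - ∫ x, f x ∂ν) ^ 2) ≤ 32 * s * ENNReal.ofReal L * D := by
    intro f hf
    have hfi : Integrable f μ := hf.integrable_of_integrable_dist hdist
    set m := ∫ x, f x ∂μ with hm
    set h : M → ℝ := fun x => f x - m with hh
    have hlip : LipschitzWith 1 h := by simpa using hf.sub (LipschitzWith.const m)
    have hmeas : Measurable h := hlip.continuous.measurable
    have hexp : ∫⁻ x, ENNReal.ofReal (Real.exp (h x ^ 2 / (4 * s))) ∂η ≤
        ENNReal.ofReal (Real.exp L) := by
      refine (lintegral_cond_le A _).trans ?_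
      rw [hexpL, ENNReal.ofReal_div_of_pos ha, ofReal_measureReal, mul_comm, div_eq_mul_inv]
      gcongr
      refine hμ.lintegral_exp_sq_le hs hlip (hfi.sub (integrable_const m)) ?_
      rw [hh, integral_sub hfi (integrable_const m)]
      simp [hm]
    have hsq : ∀ ρ : Measure M, IsProbabilityMeasure ρ →
        ∫⁻ x, ENNReal.ofReal (h x ^ 2) ∂ρ ≤ 4 * s * (klDiv ρ η + ENNReal.ofReal L) := by
      intro ρ _
      have h1 := lintegral_ofReal_le_klDiv_add (η := η) (ν := ρ)
        (φ := fun x => h x ^ 2 / (4 * s)) (by fun_prop) (fun x => by positivity)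
        (zero_le_one.trans hL) hexp
      refine le_trans (le_of_eq ?_) (mul_le_mul_right h1 _)
      rw [← lintegral_const_mul _ (by fun_prop)]
      refine lintegral_congr fun x => ?_
      have e4 : (4 * s : ℝ≥0∞) = ENNReal.ofReal (4 * s) := by
        rw [ENNReal.ofReal_mul (by norm_num)]; simp
      rw [e4, ← ENNReal.ofReal_mul (by positivity), mul_div_cancel₀ _ (by positivity)]
    have hsqη := hsq η inferInstance
    rw [klDiv_self, zero_add] at hsqη
    have hsqν := hsq ν inferInstance
    have hiη : Integrable h η := integrable_of_lintegral_sq_ne_top hmeas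
      (ne_top_of_le_ne_top (by finiteness) hsqη)
    have hiν : Integrable h ν := integrable_of_lintegral_sq_ne_top hmeas
      (ne_top_of_le_ne_top (by finiteness) hsqν)
    have hfh : f = fun x => h x + m := by ext x; simp [hh]
    have hfη : ∫ x, f x ∂η = ∫ x, h x ∂η + m := by
      rw [hfh, integral_add hiη (integrable_const m)]; simp
    have hfν : ∫ x, f x ∂ν = ∫ x, h x ∂ν + m := by
      rw [hfh, integral_add hiν (integrable_const m)]; simp
    refine ⟨hfh ▸ hiη.add (integrable_const m), hfh ▸ hiν.add (integrable_const m), ?_⟩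
    rw [hfη, hfν, add_sub_add_right_eq_sub]
    calc ENNReal.ofReal ((∫ x, h x ∂η - ∫ x, h x ∂ν) ^ 2)
        ≤ min D 2 * (2 * (4 * s * ENNReal.ofReal L + 4 * s * (D + ENNReal.ofReal L))) := by
          refine (ofReal_sq_integral_sub_le hmeas hiη hiν hac).trans ?_
          gcongr
      _ = 8 * s * (min D 2 * (D + 2 * ENNReal.ofReal L)) := by ring
      _ ≤ 8 * s * (4 * ENNReal.ofReal L * D) := mul_le_mul_right (min_two_mul_le hL') _
      _ = 32 * s * ENNReal.ofReal L * D := by ring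
  set R := 32 * (s : ℝ≥0∞) * ENNReal.ofReal L * D
  have hR : R ≠ ∞ := by finiteness
  have hW : kantorovichDist η ν ≤ ENNReal.ofReal √R.toReal := by
    refine kantorovichDist_le_of_lipschitz (fun f hf => (key f hf).1) (fun f hf => (key f hf).2.1)
      fun f hf => Real.le_sqrt_of_sq_le ?_
    exact (ENNReal.ofReal_le_iff_le_toReal hR).1 (key f hf).2.2
  calc kantorovichDist η ν ^ 2 ≤ ENNReal.ofReal √R.toReal ^ 2 := by gcongr
    _ = R := by
      rw [← ENNReal.ofReal_pow (Real.sqrt_nonneg _), Real.sq_sqrt ENNReal.toReal_nonneg,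
        ENNReal.ofReal_toReal hR]

theorem corollary4p4 :
    ∃ c : ℝ, 0 < c ∧
      ∀ (M : Type*) [MetricSpace M] [CompleteSpace M] [TopologicalSpace.SeparableSpace M]
        [MeasurableSpace M] [BorelSpace M] (μ : Measure M) [IsProbabilityMeasure μ]
        (A : Set M), IsClosed A → 0 < μ A →
        ∀ (ν : Measure M) [IsProbabilityMeasure ν], ν Aᶜ = 0 →
          -- only the indeterminate product `0 * ∞` on the right-hand side is excluded
          (subgaussianConst μ ≠ 0 ∨ klDiv ν μ[|A] ≠ ∞) →
          kantorovichDist μ[|A] ν ^ 2 ≤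
            ENNReal.ofReal c * subgaussianConst μ *
              ENNReal.ofReal (Real.log (Real.exp 1 / μ.real A)) * klDiv ν μ[|A] := by
  refine ⟨32, by norm_num, ?_⟩
  intro M _ _ _ _ _ μ _ A _ hA ν _ _ hne
  have hηp : IsProbabilityMeasure μ[|A] := cond_isProbabilityMeasure hA.ne'
  have ha : 0 < μ.real A := ENNReal.toReal_pos hA.ne' (measure_ne_top _ _)
  have hL : 1 ≤ ENNReal.ofReal (Real.log (Real.exp 1 / μ.real A)) :=
    ENNReal.one_le_ofReal.2 (one_le_log_exp_one_div ha measureReal_le_one)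
  rw [ENNReal.ofReal_ofNat]
  by_cases hD : klDiv ν μ[|A] = ∞
  · have hσ : subgaussianConst μ ≠ 0 := hne.resolve_right (not_not.2 hD)
    rw [hD, ENNReal.mul_top]
    · exact le_top
    · exact mul_ne_zero (mul_ne_zero (by norm_num) hσ) (zero_lt_one.trans_le hL).ne'
  by_cases hD0 : klDiv ν μ[|A] = 0
  · -- here `σ²` may be infinite, and then `∞ * 0 = 0`
    rw [klDiv_eq_zero_iff.1 hD0, kantorovichDist_self]
    simp
  set L := ENNReal.ofReal (Real.log (Real.exp 1 / μ.real A))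
  have hK0 : 32 * L * klDiv ν μ[|A] ≠ 0 :=
    mul_ne_zero (mul_ne_zero (by norm_num) (zero_lt_one.trans_le hL).ne') hD0
  have hK : 32 * L * klDiv ν μ[|A] ≠ ∞ := by finiteness
  rw [show 32 * subgaussianConst μ * L * klDiv ν μ[|A] =
    32 * L * klDiv ν μ[|A] * subgaussianConst μ by ring, ← ENNReal.div_le_iff' hK0 hK]
  -- pass to the infimum along strictly larger, hence positive, admissible values
  refine le_of_forall_gt_imp_ge_of_dense fun b hb => ?_
  obtain ⟨t, ht, htb⟩ := ENNReal.lt_iff_exists_nnreal_btwn.1 hb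
  obtain ⟨s, hs⟩ := iInf_lt_iff.1 ht
  obtain ⟨hs, hst⟩ := iInf_lt_iff.1 hs
  have hst' : s < t := ENNReal.coe_lt_coe.1 hst
  refine le_trans ?_ htb.le
  rw [ENNReal.div_le_iff' hK0 hK]
  refine ((hs.mono hst'.le).kantorovichDist_cond_sq_le (bot_le.trans_lt hst') hA hD).trans_eq ?_
  ring
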